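/- Consider $n$ items with unknown real values $x_1,\dots,x_n$. Items can only be compared through an adversarial comparator: asked to compare items $i$ and $j$, it returns one of the two items; if $|x_i-x_j|>1$ it must return the item with the larger value, and otherwise it may return either one. The adversary is adaptive: its answers may depend on all queries made by the algorithm so far. An algorithm takes $d$ rounds if its comparisons are asked in $d$ (possibly empty) batches, where each batch depends only on the answers to the earlier batches. An ordering $y_1,\dots,y_n$ of the items (identified with their values) is a $k$-approximate sorting if $y_j\ge y_i-k$ for all $i<j$. **Theorem.** For every integer $d>0$ there is a deterministic algorithm that, for every $n$, every choice of the $n$ values and every adaptive adversarial comparator, takes $d$ rounds, uses at most $d\cdot n^{1+2/\sqrt d}$ comparisons, and returns a $2d$-approximate sorting of the $n$ items. -/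

import Mathlib

namespace ImpreciseSorting

/-- One query: a pair of (indices of) items to be compared. -/
abbrev Query (n : ℕ) : Type := Fin n × Fin n

/-- One completed round: the batch of queries that were asked simultaneously, together with the
item that was returned as the winner of each of them. -/
abbrev RoundRecord (n : ℕ) : Type := Σ qs : List (Query n), (Fin qs.length → Fin n)

/-- `w` is a possible answer of an imprecise comparator (threshold `1`) to the comparison of the
items `i` and `j` with hidden values `x`: it is one of the two items, and it is the one of larger
value whenever the two values differ by more than `1`. -/
def IsPossibleAnswer {n : ℕ} (x : Fin n → ℝ) (i j w : Fin n) : Prop :=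
  (w = i ∨ w = j) ∧ (1 < |x i - x j| → x w = max (x i) (x j))

/-- An adaptive adversarial comparator for the hidden values `x`. Its answers to a batch of
queries may depend on all earlier rounds and on the whole current batch (in particular, it may
answer a repeated query differently). -/
structure AdaptiveComparator {n : ℕ} (x : Fin n → ℝ) where
  answer : List (RoundRecord n) → (qs : List (Query n)) → Fin qs.length → Fin n
  possible : ∀ (history : List (RoundRecord n)) (qs : List (Query n)) (t : Fin qs.length),
    IsPossibleAnswer x (qs.get t).1 (qs.get t).2 (answer history qs t)

/-- A deterministic algorithm on `n` items that takes `d` rounds and returns an ordering of the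
items: a decision tree which in each round asks a (possibly empty) batch of comparisons, where the
next batch, or at the end the returned ordering, depends only on the answers received so far.
The ordering `σ` puts the item `σ p` at position `p`. -/
inductive RoundAlgorithm (n : ℕ) : ℕ → Type
  | done (σ : Equiv.Perm (Fin n)) : RoundAlgorithm n 0
  | round {d : ℕ} (qs : List (Query n))
      (next : (Fin qs.length → Fin n) → RoundAlgorithm n d) : RoundAlgorithm n (d + 1)

namespace RoundAlgorithm

/-- The ordering returned when the rounds in `history` have already taken place and the algorithm
is continued against the comparator `C`. -/
def outputFrom {n : ℕ} {x : Fin n → ℝ} (C : AdaptiveComparator x) :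
    {d : ℕ} → RoundAlgorithm n d → List (RoundRecord n) → Equiv.Perm (Fin n)
  | _, done σ, _ => σ
  | _, round qs next, history =>
      outputFrom C (next (C.answer history qs)) (history ++ [⟨qs, C.answer history qs⟩])

/-- The number of comparisons (with repetitions) asked when the rounds in `history` have already
taken place and the algorithm is continued against the comparator `C`. -/
def comparisonsFrom {n : ℕ} {x : Fin n → ℝ} (C : AdaptiveComparator x) :
    {d : ℕ} → RoundAlgorithm n d → List (RoundRecord n) → ℕ
  | _, done _, _ => 0
  | _, round qs next, history =>
      qs.length +
        comparisonsFrom C (next (C.answer history qs)) (history ++ [⟨qs, C.answer history qs⟩])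

/-- The ordering returned by the algorithm `A` against the comparator `C`. -/
def output {n d : ℕ} {x : Fin n → ℝ} (A : RoundAlgorithm n d) (C : AdaptiveComparator x) :
    Equiv.Perm (Fin n) :=
  A.outputFrom C []

/-- The total number of comparisons made by the algorithm `A` against the comparator `C`. -/
def comparisons {n d : ℕ} {x : Fin n → ℝ} (A : RoundAlgorithm n d) (C : AdaptiveComparator x) :
    ℕ :=
  A.comparisonsFrom C []

end RoundAlgorithm

/-- The ordering `σ 0, σ 1, …, σ (n - 1)` of the items with values `x` is a `k`-approximate
sorting (in increasing order): a later item is never smaller than an earlier one by more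
than `k`. -/
def IsApproxSorting {n : ℕ} (x : Fin n → ℝ) (k : ℝ) (σ : Equiv.Perm (Fin n)) : Prop :=
  ∀ p q : Fin n, p < q → x (σ q) ≥ x (σ p) - k

end ImpreciseSorting

namespace ImpreciseSorting

/-! Comparing all pairs and ordering by the number of wins takes one round and has error 2
(`wins_lt_wins`). Larger sets are split by pivots into buckets, which are sorted recursively in
parallel. Two items in one bucket suffer only the recursive error, two items in different buckets
only that of the bucketing, so errors combine by a maximum and not by a sum (`CanSort.step`).

Comparing every item with every pivot is too expensive, so each item first gets a short range of
pivots (`exists_refinement`). Groups of size `g` are sorted by all pairs, every `b`-th item of each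
group is kept as a sample, and the sample is treated in the same way with groups `b` times as large;
no level costs more than the first. The last sample is sorted completely and yields the pivots. On
the way back an item inherits its range from sampled items of its group, at the price of 2 in error.
Few ranges contain a given number, since each group adds at most one block of `b` items
(`IsGrouped.exists_location`). This bounds both the comparisons with the pivots and the bucket
sizes.

In `canSort_pow`, passing from `q ^ (t + 2)` to `q ^ (t + 3)` items uses about `t / 2` sampling
levels and `t * q ^ 2` comparisons per item, about `t ^ 2 * q ^ 2 / 2` in total. Taking `t + 2` near
`√d` and `q` near `n ^ (1 / √d)` gives the theorem, with small `n` treated separately. -/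

/-! ### Decision trees and their combinators -/

/-- A decision tree with `R` rounds and a result in `α`: each round asks a finite set of queries,
and the rest of the tree depends on a table of answers (of which only the entries at the queries
asked are meaningful). -/
def Strategy (n : ℕ) (α : Type) : ℕ → Type
  | 0 => α
  | R + 1 => Finset (Query n) × ((Query n → Fin n) → Strategy n α R)

namespace Strategy

variable {n : ℕ} {α β ι : Type}

/-- Against every comparator for the values `x`, the strategy asks at most `c` queries and its
result satisfies `P`. -/
def Ensures (x : Fin n → ℝ) : {R : ℕ} → Strategy n α R → ℝ → (α → Prop) → Prop
  | 0, a, c, P => 0 ≤ c ∧ P a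
  | _ + 1, A, c, P => ∀ w : Query n → Fin n, (∀ e ∈ A.1, IsPossibleAnswer x e.1 e.2 (w e)) →
      Ensures x (A.2 w) (c - A.1.card) P

theorem Ensures.mono {x : Fin n → ℝ} : ∀ {R : ℕ} {A : Strategy n α R} {c c' : ℝ}
    {P Q : α → Prop}, A.Ensures x c P → c ≤ c' → (∀ a, P a → Q a) → A.Ensures x c' Q
  | 0, _, _, _, _, _, h, hc, hPQ => ⟨h.1.trans hc, hPQ _ h.2⟩
  | _ + 1, _, _, _, _, _, h, hc, hPQ => fun w hw => (h w hw).mono (by linarith) hPQ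

/-- Apply a function to the result of a strategy. -/
def map (f : α → β) : {R : ℕ} → Strategy n α R → Strategy n β R
  | 0, a => f a
  | _ + 1, A => (A.1, fun w => map f (A.2 w))

theorem Ensures.map {x : Fin n → ℝ} {f : α → β} : ∀ {R : ℕ} {A : Strategy n α R} {c : ℝ}
    {Q : β → Prop}, A.Ensures x c (fun a => Q (f a)) → (A.map f).Ensures x c Q
  | 0, _, _, _, h => h
  | _ + 1, _, _, _, h => fun w hw => (h w hw).map

/-- Run a strategy, and then another one that depends on the result of the first. -/
def bind {R' : ℕ} (f : α → Strategy n β R') : {R : ℕ} → Strategy n α R → Strategy n β (R' + R)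
  | 0, a => f a
  | _ + 1, A => (A.1, fun w => bind f (A.2 w))

theorem Ensures.bind {x : Fin n → ℝ} {R' : ℕ} {f : α → Strategy n β R'} {c' : ℝ}
    {P : α → Prop} {Q : β → Prop} (hf : ∀ a, P a → (f a).Ensures x c' Q) :
    ∀ {R : ℕ} {A : Strategy n α R} {c : ℝ}, A.Ensures x c P → (A.bind f).Ensures x (c + c') Q
  | 0, _, _, h => (hf _ h.2).mono (by linarith [h.1]) fun _ => id
  | _ + 1, _, _, h => fun w hw => ((h w hw).bind hf).mono
      (by simp only [Strategy.bind]; linarith) fun _ => id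

/-- Run finitely many strategies in parallel. -/
def par (I : Finset ι) : {R : ℕ} → (ι → Strategy n α R) → Strategy n (ι → α) R
  | 0, a => a
  | _ + 1, A => (I.biUnion fun i => (A i).1, fun w => par I fun i => (A i).2 w)

/-- A query common to several strategies is asked once and all of them read the same answer, so the
union costs at most the sum. -/
theorem Ensures.par {x : Fin n → ℝ} {I : Finset ι} {P : ι → α → Prop} : ∀ {R : ℕ}
    {A : ι → Strategy n α R} {c : ι → ℝ}, (∀ i ∈ I, (A i).Ensures x (c i) (P i)) →
    (Strategy.par I A).Ensures x (∑ i ∈ I, c i) fun f => ∀ i ∈ I, P i (f i)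
  | 0, _, _, h => ⟨Finset.sum_nonneg fun i hi => (h i hi).1, fun i hi => (h i hi).2⟩
  | _ + 1, A, c, h => fun w hw => by
      have key := Ensures.par (x := x) (I := I) (P := P) (A := fun i => (A i).2 w)
        (c := fun i => c i - (A i).1.card) fun i hi =>
          h i hi w fun e he => hw e (Finset.mem_biUnion.2 ⟨i, hi, he⟩)
      refine key.mono ?_ fun _ => id
      rw [Finset.sum_sub_distrib]
      have : ((I.biUnion fun i => (A i).1).card : ℝ) ≤ ∑ i ∈ I, ((A i).1.card : ℝ) := by
        exact_mod_cast Finset.card_biUnion_le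
      exact sub_le_sub_left this _

theorem exists_ensures_of_le {R R' : ℕ} (h : R ≤ R') (A : Strategy n α R) :
    ∃ A' : Strategy n α R', ∀ (x : Fin n → ℝ) (c : ℝ) (P : α → Prop),
      A.Ensures x c P → A'.Ensures x c P := by
  induction h with
  | refl => exact ⟨A, fun _ _ _ => id⟩
  | step _ ih =>
    obtain ⟨A', hA'⟩ := ih
    exact ⟨(∅, fun _ => A'), fun x c P hA w _ =>
      (hA' x c P hA).mono (by simp) fun _ => id⟩

open Classical in
/-- The table with the given answers to the queries in `E`. -/
noncomputable def table (E : Finset (Query n)) (ans : Fin E.toList.length → Fin n)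
    (e : Query n) : Fin n :=
  if h : e ∈ E then ans ⟨E.toList.idxOf e, List.idxOf_lt_length_of_mem (Finset.mem_toList.2 h)⟩
  else e.1

/-- The decision tree in which every set of queries is asked as a list. -/
noncomputable def toAlgorithm :
    {R : ℕ} → Strategy n (Equiv.Perm (Fin n)) R → RoundAlgorithm n R
  | 0, σ => .done σ
  | _ + 1, A => .round A.1.toList fun ans => toAlgorithm (A.2 (table A.1 ans))

theorem Ensures.toAlgorithm {x : Fin n → ℝ} (C : AdaptiveComparator x) : ∀ {R : ℕ}
    {A : Strategy n (Equiv.Perm (Fin n)) R} {c : ℝ} {P : Equiv.Perm (Fin n) → Prop}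
    (_ : A.Ensures x c P) (history : List (RoundRecord n)),
    (A.toAlgorithm.comparisonsFrom C history : ℝ) ≤ c ∧ P (A.toAlgorithm.outputFrom C history)
  | 0, _, _, _, h, _ => by
      simp only [Strategy.toAlgorithm, RoundAlgorithm.comparisonsFrom,
        RoundAlgorithm.outputFrom, Nat.cast_zero]
      exact h
  | _ + 1, A, c, P, h, history => by
      have hw : ∀ e ∈ A.1, IsPossibleAnswer x e.1 e.2
          (table A.1 (C.answer history A.1.toList) e) := by
        intro e he
        have key := C.possible history A.1.toList
          ⟨A.1.toList.idxOf e, List.idxOf_lt_length_of_mem (Finset.mem_toList.2 he)⟩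
        simp only [table, he, dite_true]
        simpa [List.get_eq_getElem, List.getElem_idxOf] using key
      obtain ⟨h1, h2⟩ := (h _ hw).toAlgorithm C
        (history ++ [⟨A.1.toList, C.answer history A.1.toList⟩])
      simp only [Strategy.toAlgorithm, RoundAlgorithm.comparisonsFrom,
        RoundAlgorithm.outputFrom]
      refine ⟨?_, h2⟩
      push_cast
      rw [Finset.length_toList]
      linarith

end Strategy

/-! ### Sorting in one round -/

theorem IsPossibleAnswer.le_of_fst {n : ℕ} {x : Fin n → ℝ} {i j : Fin n}
    (h : IsPossibleAnswer x i j i) : x j ≤ x i + 1 := by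
  by_contra hlt
  push Not at hlt
  have := h.2 (by rw [abs_sub_comm]; exact lt_of_lt_of_le (by linarith) (le_abs_self _))
  linarith [le_max_right (x i) (x j)]

theorem IsPossibleAnswer.le_of_snd {n : ℕ} {x : Fin n → ℝ} {i j : Fin n}
    (h : IsPossibleAnswer x i j j) : x i ≤ x j + 1 := by
  by_contra hlt
  push Not at hlt
  have := h.2 (lt_of_lt_of_le (by linarith) (le_abs_self _))
  linarith [le_max_left (x i) (x j)]

/-- The list `l` enumerates the items in `S`, and no item in it is followed by one that is smaller
by more than `k`. -/
structure IsOrdering {n : ℕ} (x : Fin n → ℝ) (S : Finset (Fin n)) (k : ℝ)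
    (l : List (Fin n)) : Prop where
  nodup : l.Nodup
  mem_iff : ∀ a, a ∈ l ↔ a ∈ S
  pairwise : l.Pairwise fun a b => x a ≤ x b + k

/-- All sets of at most `N` of the `n` items can be sorted in `R` rounds, with `c` comparisons per
item and with error `k`. -/
def CanSort (n R : ℕ) (N c k : ℝ) : Prop :=
  ∀ S : Finset (Fin n), (S.card : ℝ) ≤ N → ∃ A : Strategy n (List (Fin n)) R,
    ∀ x : Fin n → ℝ, A.Ensures x (c * S.card) (IsOrdering x S k)

theorem CanSort.mono {n R R' : ℕ} {N c c' k k' : ℝ} (h : CanSort n R N c k) (hR : R ≤ R')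
    (hc : c ≤ c') (hk : k ≤ k') : CanSort n R' N c' k' := by
  intro S hS
  obtain ⟨A, hA⟩ := h S hS
  obtain ⟨A', hA'⟩ := Strategy.exists_ensures_of_le hR A
  refine ⟨A', fun x => (hA' x _ _ (hA x)).mono (by gcongr) fun l hl => ⟨hl.1, hl.2, ?_⟩⟩
  exact hl.3.imp fun h => by linarith

/-- The comparisons of all pairs of items in `S`, each in one orientation. -/
def pairs {n : ℕ} (S : Finset (Fin n)) : Finset (Query n) :=
  S.offDiag.filter fun e => e.1 < e.2

theorem card_pairs_le {n : ℕ} (S : Finset (Fin n)) :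
    ((pairs S).card : ℝ) ≤ (S.card - 1) / 2 * S.card := by
  have h1 : (pairs S).card = (S.offDiag.filter fun e => ¬ e.1 < e.2).card := by
    refine Finset.card_bij (fun e _ => e.swap) ?_ ?_ ?_
    · rintro ⟨a, b⟩ h
      simp only [pairs, Finset.mem_filter, Finset.mem_offDiag, Prod.swap] at h ⊢
      exact ⟨⟨h.1.2.1, h.1.1, h.1.2.2.symm⟩, h.2.le.not_gt⟩
    · intro a _ b _ h
      exact Prod.swap_injective h
    · rintro ⟨a, b⟩ h
      simp only [pairs, Finset.mem_filter, Finset.mem_offDiag, not_lt] at h ⊢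
      exact ⟨(b, a), ⟨⟨h.1.2.1, h.1.1, h.1.2.2.symm⟩, lt_of_le_of_ne h.2 h.1.2.2.symm⟩, rfl⟩
  have h2 : (pairs S).card + (S.offDiag.filter fun e => ¬ e.1 < e.2).card = S.offDiag.card :=
    Finset.card_filter_add_card_filter_not _
  have h3 : (pairs S).card + (pairs S).card + S.card = S.card * S.card := by
    have h4 : S.offDiag.card = S.card * S.card - S.card := Finset.offDiag_card S
    have h5 : S.card ≤ S.card * S.card := Nat.le_mul_self _
    omega
  have h4 : ((pairs S).card : ℝ) + (pairs S).card + S.card = S.card * S.card := by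
    exact_mod_cast h3
  linarith

/-- The winner of the comparison of `a` and `b`. -/
def winner {n : ℕ} (w : Query n → Fin n) (a b : Fin n) : Fin n :=
  if a < b then w (a, b) else w (b, a)

/-- The number of items in `S` that lose against `a`. -/
def wins {n : ℕ} (S : Finset (Fin n)) (w : Query n → Fin n) (a : Fin n) : ℕ :=
  (S.filter fun b => b ≠ a ∧ winner w a b = a).card

/-- Whatever loses to `b` is at most `x b + 1 < x a - 1` and therefore loses to `a`; in addition `a`
beats `b` itself. -/
theorem wins_lt_wins {n : ℕ} {x : Fin n → ℝ} {S : Finset (Fin n)} {w : Query n → Fin n}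
    (hw : ∀ e ∈ pairs S, IsPossibleAnswer x e.1 e.2 (w e)) {a b : Fin n} (ha : a ∈ S)
    (hb : b ∈ S) (hab : x b + 2 < x a) : wins S w b < wins S w a := by
  have key : ∀ u ∈ S, ∀ v ∈ S, u ≠ v →
      (winner w u v = u ∧ x v ≤ x u + 1) ∨ (winner w u v = v ∧ x u ≤ x v + 1) := by
    intro u hu v hv huv
    unfold winner
    rcases lt_or_gt_of_ne huv with h | h
    · have := hw (u, v) (by simp [pairs, hu, hv, huv, h])
      rw [if_pos h]
      rcases this.1 with h1 | h1 <;> rw [h1] at this <;> dsimp only at h1 this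
      · left; exact ⟨h1, this.le_of_fst⟩
      · right; exact ⟨h1, this.le_of_snd⟩
    · have := hw (v, u) (by simp [pairs, hu, hv, huv.symm, h])
      rw [if_neg h.le.not_gt]
      rcases this.1 with h1 | h1 <;> rw [h1] at this <;> dsimp only at h1 this
      · right; exact ⟨h1, this.le_of_fst⟩
      · left; exact ⟨h1, this.le_of_snd⟩
  have beats : ∀ u ∈ S, u ≠ a → x u + 1 < x a → winner w a u = a := by
    intro u hu hua h
    rcases key a ha u hu hua.symm with h1 | h1
    · exact h1.1
    · linarith [h1.2]
  have hne : b ≠ a := by rintro rfl; linarith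
  refine Finset.card_lt_card ⟨?_, ?_⟩
  · intro u hu
    simp only [Finset.mem_filter] at hu ⊢
    obtain ⟨huS, hub, h⟩ := hu
    have hxu : x u ≤ x b + 1 := by
      rcases key b hb u huS hub.symm with h1 | h1
      · exact h1.2
      · exact absurd (h1.1.symm.trans h) hub
    have hua : u ≠ a := by rintro rfl; linarith
    exact ⟨huS, hua, beats u huS hua (by linarith)⟩
  · intro hsub
    have : b ∈ S.filter fun u => u ≠ a ∧ winner w a u = a := by
      simp only [Finset.mem_filter]
      exact ⟨hb, hne, beats b hb hne (by linarith)⟩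
    simpa using hsub this

theorem canSort_one (n : ℕ) (N : ℝ) : CanSort n 1 N ((N - 1) / 2) 2 := by
  intro S hS
  refine ⟨(pairs S, fun w => S.toList.mergeSort fun a b => decide (wins S w a ≤ wins S w b)),
    fun x w hw => ⟨?_, ?_, ?_, ?_⟩⟩
  · have h1 := card_pairs_le S
    have h2 : ((S.card : ℝ) - 1) / 2 * S.card ≤ (N - 1) / 2 * S.card := by gcongr
    linarith
  · exact (List.mergeSort_perm _ _).nodup_iff.2 S.nodup_toList
  · intro a
    rw [(List.mergeSort_perm _ _).mem_iff, Finset.mem_toList]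
  · have hs := List.pairwise_mergeSort (le := fun a b => decide (wins S w a ≤ wins S w b))
      (by intro a b c; simpa using le_trans) (by intro a b; simpa using le_total _ _) S.toList
    refine List.Pairwise.imp_of_mem ?_ hs
    intro a b ha hb h
    rw [(List.mergeSort_perm _ _).mem_iff, Finset.mem_toList] at ha hb
    by_contra hlt
    push Not at hlt
    have := wins_lt_wins hw ha hb hlt
    simp only [decide_eq_true_eq] at h
    omega

/-! ### Pivots and ranges -/

variable {n : ℕ}

theorem IsOrdering.le_of_idxOf_le {x : Fin n → ℝ} {S : Finset (Fin n)} {k : ℝ}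
    {l : List (Fin n)} (h : IsOrdering x S k l) (hk : 0 ≤ k) {a b : Fin n} (ha : a ∈ S)
    (hb : b ∈ S) (hab : l.idxOf a ≤ l.idxOf b) : x a ≤ x b + k := by
  have ha' := List.idxOf_lt_length_of_mem ((h.mem_iff a).2 ha)
  have hb' := List.idxOf_lt_length_of_mem ((h.mem_iff b).2 hb)
  rcases hab.lt_or_eq with hlt | heq
  · have := List.pairwise_iff_getElem.1 h.pairwise _ _ ha' hb' hlt
    simpa using this
  · have : a = b := (List.idxOf_inj ((h.mem_iff a).2 ha)).1 heq
    subst this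
    linarith

theorem IsOrdering.length_eq {x : Fin n → ℝ} {S : Finset (Fin n)} {k : ℝ}
    {l : List (Fin n)} (h : IsOrdering x S k l) : l.length = S.card := by
  rw [← List.toFinset_card_of_nodup h.nodup]
  congr 1
  ext a
  simp [h.mem_iff]

/-- A list of pivots, and for each item a range of the possible numbers of pivots below it. -/
structure Location (n : ℕ) : Type where
  pivots : List (Fin n)
  lo : Fin n → ℕ
  hi : Fin n → ℕ

/-- The items in `S` that may have exactly `β` pivots below them. -/
def Location.near (D : Location n) (S : Finset (Fin n)) (β : ℕ) : Finset (Fin n) :=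
  S.filter fun a => D.lo a ≤ β ∧ β ≤ D.hi a

/-- The ranges of the items in `S` are correct with error `e`. -/
structure Location.IsValid (D : Location n) (x : Fin n → ℝ) (S : Finset (Fin n)) (e : ℝ) :
    Prop where
  lo_le_hi : ∀ a ∈ S, D.lo a ≤ D.hi a
  hi_le : ∀ a ∈ S, D.hi a ≤ D.pivots.length
  pivot_le : ∀ a ∈ S, ∀ j, (hj : j < D.pivots.length) → j < D.lo a →
    x D.pivots[j] ≤ x a + e
  le_pivot : ∀ a ∈ S, ∀ j, (hj : j < D.pivots.length) → D.hi a ≤ j →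
    x a ≤ x D.pivots[j] + e

/-- The location with every `c`-th item of a list as a pivot. -/
def Location.ofList (c : ℕ) (l : List (Fin n)) : Location n where
  -- Pivot `j` ends the `j`-th run of `c` items, so exactly `l.idxOf a / c` pivots strictly precede
  -- an item `a` of the list.
  pivots := List.ofFn fun j : Fin (l.length / c) => l[(j + 1) * c - 1]'(by
    have h1 := j.2
    have h2 : ((j : ℕ) + 1) * c ≤ l.length := (Nat.mul_le_mul_right c h1).trans
      (Nat.div_mul_le_self _ _)
    rcases Nat.eq_zero_or_pos c with rfl | hc
    · simp at h1
    · have : 0 < ((j : ℕ) + 1) * c := by positivity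
      omega)
  lo a := l.idxOf a / c
  hi a := l.idxOf a / c

theorem Location.isValid_ofList {x : Fin n → ℝ} {S : Finset (Fin n)} {k : ℝ}
    {l : List (Fin n)} (h : IsOrdering x S k l) (hk : 0 ≤ k) {c : ℕ} (hc : 0 < c) :
    (Location.ofList c l).IsValid x S k := by
  have hlen : (Location.ofList c l).pivots.length = l.length / c := by simp [ofList]
  have hpos : ∀ j, (hj : j < (Location.ofList c l).pivots.length) →
      (Location.ofList c l).pivots[j] ∈ S ∧
        l.idxOf (Location.ofList c l).pivots[j] + 1 = (j + 1) * c := by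
    intro j hj
    have h0 : 0 < (j + 1) * c := by positivity
    have h1 : (Location.ofList c l).pivots[j] = l[(j + 1) * c - 1]'(by
        have h2 : (j + 1) * c ≤ l.length := (Nat.mul_le_mul_right c (hlen ▸ hj)).trans
          (Nat.div_mul_le_self _ _)
        omega) := by simp [ofList]
    rw [h1]
    refine ⟨(h.mem_iff _).1 (List.getElem_mem _), ?_⟩
    rw [h.nodup.idxOf_getElem]
    omega
  refine ⟨fun a _ => le_rfl, fun a ha => ?_, fun a ha j hj hja => ?_, fun a ha j hj hja => ?_⟩
  · rw [hlen]
    exact Nat.div_le_div_right (List.idxOf_lt_length_of_mem ((h.mem_iff a).2 ha)).le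
  · obtain ⟨h1, h2⟩ := hpos j hj
    refine h.le_of_idxOf_le hk h1 ha ?_
    have : (j + 1) * c ≤ l.idxOf a := (Nat.le_div_iff_mul_le hc).1 hja
    omega
  · obtain ⟨h1, h2⟩ := hpos j hj
    refine h.le_of_idxOf_le hk ha h1 ?_
    have : l.idxOf a < (j + 1) * c := (Nat.div_lt_iff_lt_mul hc).1 (Nat.lt_succ_of_le hja)
    omega

theorem Location.card_near_ofList {x : Fin n → ℝ} {S : Finset (Fin n)} {k : ℝ}
    {l : List (Fin n)} (h : IsOrdering x S k l) {c : ℕ} (hc : 0 < c) (β : ℕ) :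
    ((Location.ofList c l).near S β).card ≤ c := by
  have : ((Location.ofList c l).near S β).card ≤ (Finset.Ico (β * c) (β * c + c)).card := by
    refine Finset.card_le_card_of_injOn l.idxOf ?_ ?_
    · intro a ha
      have h0 := (Finset.mem_filter.1 (Finset.mem_coe.1 ha)).2
      have h1 : l.idxOf a / c = β := le_antisymm h0.1 h0.2
      have h2 := Nat.div_add_mod (l.idxOf a) c
      have h3 := Nat.mod_lt (l.idxOf a) hc
      rw [h1, mul_comm] at h2
      simp only [Finset.coe_Ico, Set.mem_Ico]
      omega
    · intro a ha b _ hab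
      simp only [near, Finset.coe_filter, Set.mem_ofPred_eq] at ha
      exact (List.idxOf_inj ((h.mem_iff a).2 ha.1)).1 hab
  simpa using this

theorem exists_grouping (S : Finset (Fin n)) {g : ℕ} (hg : 0 < g) :
    ∃ γ : Fin n → ℕ, (∀ a ∈ S, γ a < S.card / g + 1) ∧
      ∀ i, (S.filter fun a => γ a = i).card ≤ g := by
  refine ⟨fun a => S.toList.idxOf a / g, fun a ha => ?_, fun i => ?_⟩
  · have := List.idxOf_lt_length_of_mem (Finset.mem_toList.2 ha)
    rw [Finset.length_toList] at this
    exact Nat.lt_succ_of_le (Nat.div_le_div_right this.le)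
  · have : (S.filter fun a => S.toList.idxOf a / g = i).card ≤
        (Finset.Ico (i * g) (i * g + g)).card := by
      refine Finset.card_le_card_of_injOn S.toList.idxOf ?_ ?_
      · intro a ha
        simp only [Finset.coe_filter, Set.mem_ofPred_eq] at ha
        have h2 := Nat.div_add_mod (S.toList.idxOf a) g
        have h3 := Nat.mod_lt (S.toList.idxOf a) hg
        rw [ha.2, mul_comm] at h2
        simp only [Finset.coe_Ico, Set.mem_Ico]
        omega
      · intro a ha b _ hab
        simp only [Finset.coe_filter, Set.mem_ofPred_eq] at ha
        exact (List.idxOf_inj (Finset.mem_toList.2 ha.1)).1 hab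
    simpa using this

/-- Supplies upper ends of ranges: a value below the cap `k` has a witness, and without a witness
the value is `k`, the number of pivots, which claims nothing. -/
theorem exists_min_bound {ι : Type*} (U : Finset ι) (f : ι → ℕ) (k : ℕ) :
    ∃ B ≤ k, (∀ u ∈ U, B ≤ f u) ∧ (B < k → ∃ u ∈ U, f u = B) := by
  classical
  refine ⟨(insert k (U.image f)).min' (Finset.insert_nonempty _ _), ?_, ?_, ?_⟩
  · exact Finset.min'_le _ _ (Finset.mem_insert_self _ _)
  · exact fun u hu =>
      Finset.min'_le _ _ (Finset.mem_insert_of_mem (Finset.mem_image_of_mem f hu))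
  · intro h
    have := Finset.min'_mem (insert k (U.image f)) (Finset.insert_nonempty _ _)
    rw [Finset.mem_insert, Finset.mem_image] at this
    rcases this with h1 | h1
    · exact absurd h1 h.ne
    · exact h1

/-! ### Sampling from sorted groups -/

/-- The set `S` is divided into at most `G` groups, each of which is put into an order. -/
structure IsGrouped (S : Finset (Fin n)) (γ pos : Fin n → ℕ) (G : ℕ) : Prop where
  lt : ∀ a ∈ S, γ a < G
  inj : ∀ a ∈ S, ∀ b ∈ S, γ a = γ b → pos a = pos b → a = b
  surj : ∀ a ∈ S, ∀ m ≤ pos a, ∃ b ∈ S, γ b = γ a ∧ pos b = m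

/-- The sample that contains every `b`-th item of each group. -/
def sample (S : Finset (Fin n)) (pos : Fin n → ℕ) (b : ℕ) : Finset (Fin n) :=
  S.filter fun a => b ∣ pos a + 1

/-- A sampled item and the `b - 1` items before it in its group form a run, and these runs are
disjoint; `(u, s)` is sent to the item `s` places before `u`. -/
theorem IsGrouped.card_sample_mul_le {S : Finset (Fin n)} {γ pos : Fin n → ℕ} {G : ℕ}
    (h : IsGrouped S γ pos G) (b : ℕ) : (sample S pos b).card * b ≤ S.card := by
  have hex : ∀ p : Fin n × ℕ, ∃ a, p.1 ∈ S → a ∈ S ∧ γ a = γ p.1 ∧ pos a = pos p.1 - p.2 := by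
    intro p
    by_cases hp : p.1 ∈ S
    · obtain ⟨a, h1, h2, h3⟩ := h.surj p.1 hp _ (Nat.sub_le _ p.2)
      exact ⟨a, fun _ => ⟨h1, h2, h3⟩⟩
    · exact ⟨p.1, fun h => absurd h hp⟩
  choose f hf using hex
  rw [← Finset.card_range b, ← Finset.card_product, Finset.card_range]
  refine Finset.card_le_card_of_injOn f ?_ ?_
  · intro p hp
    simp only [Finset.coe_product, Set.mem_prod, Finset.mem_coe, sample, Finset.mem_filter] at hp
    exact (hf p hp.1.1).1
  · rintro ⟨u, s⟩ hu ⟨v, t⟩ hv huv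
    simp only [Finset.coe_product, Set.mem_prod, Finset.mem_coe, sample, Finset.mem_filter,
      Finset.mem_range] at hu hv
    obtain ⟨-, h1, h2⟩ := hf (u, s) hu.1.1
    obtain ⟨-, h3, h4⟩ := hf (v, t) hv.1.1
    rw [huv] at h1 h2
    obtain ⟨y, hy⟩ := hu.1.2
    obtain ⟨z, hz⟩ := hv.1.2
    have hsb := hu.2
    have htb := hv.2
    simp only at h1 h2 h3 h4
    have hy0 : 0 < y := by
      rcases Nat.eq_zero_or_pos y with rfl | h0
      · simp at hy
      · exact h0
    have hz0 : 0 < z := by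
      rcases Nat.eq_zero_or_pos z with rfl | h0
      · simp at hz
      · exact h0
    have hby : b ≤ b * y := Nat.le_mul_of_pos_right _ hy0
    have hbz : b ≤ b * z := Nat.le_mul_of_pos_right _ hz0
    have hyz : y = z := by
      by_contra hne
      rcases lt_or_gt_of_ne hne with hlt | hlt
      · have : b * y + b ≤ b * z := by
          rw [← Nat.mul_succ]; exact Nat.mul_le_mul_left _ hlt
        omega
      · have : b * z + b ≤ b * y := by
          rw [← Nat.mul_succ]; exact Nat.mul_le_mul_left _ hlt
        omega
    subst hyz
    have huv' : u = v := h.inj u hu.1.1 v hv.1.1 (h1.symm.trans h3) (by omega)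
    subst huv'
    have : s = t := by omega
    rw [this]

theorem IsGrouped.card_le_mul_card_image {S T : Finset (Fin n)} {γ pos : Fin n → ℕ} {G : ℕ}
    (h : IsGrouped S γ pos G) {b : ℕ} (hb : 0 < b) (hT : T ⊆ S) :
    T.card ≤ b * (T.image fun a => (γ a, (pos a + 1) / b)).card := by
  refine Finset.card_le_mul_card_image _ _ ?_
  rintro ⟨i, r⟩ -
  have : (T.filter fun a => (γ a, (pos a + 1) / b) = (i, r)).card ≤
      (Finset.Ico (r * b) (r * b + b)).card := by
    refine Finset.card_le_card_of_injOn (fun a => pos a + 1) ?_ ?_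
    · intro a ha
      simp only [Finset.coe_filter, Set.mem_ofPred_eq, Prod.mk.injEq] at ha
      have h2 := Nat.div_add_mod (pos a + 1) b
      have h3 := Nat.mod_lt (pos a + 1) hb
      rw [ha.2.2, mul_comm] at h2
      simp only [Finset.coe_Ico, Set.mem_Ico]
      omega
    · intro a ha a' ha' haa
      simp only [Finset.coe_filter, Set.mem_ofPred_eq, Prod.mk.injEq] at ha ha'
      exact h.inj a (hT ha.1) a' (hT ha'.1) (ha.2.1.trans ha'.2.1.symm) (by simpa using haa)
  simpa using this

/-- Ranges of the numbers of pivots below the items of a sample give ranges for all items. -/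
theorem IsGrouped.exists_location {S : Finset (Fin n)} {γ pos : Fin n → ℕ} {G : ℕ}
    (h : IsGrouped S γ pos G) {b : ℕ} (hb : 0 < b) (D : Location n)
    (hD : ∀ u ∈ sample S pos b, D.lo u ≤ D.hi u ∧ D.hi u ≤ D.pivots.length) :
    ∃ D' : Location n, D'.pivots = D.pivots ∧
      (∀ a ∈ S, D'.lo a ≤ D'.hi a ∧ D'.hi a ≤ D'.pivots.length ∧
        (∀ j < D'.lo a, ∃ u ∈ sample S pos b, γ u = γ a ∧ pos u ≤ pos a ∧ j < D.lo u) ∧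
        (∀ j < D'.pivots.length, D'.hi a ≤ j →
          ∃ u ∈ sample S pos b, γ u = γ a ∧ pos a ≤ pos u ∧ D.hi u ≤ j)) ∧
      ∀ β, (D'.near S β).card ≤ b * (G + (D.near (sample S pos b) β).card) := by
  classical
  -- `r` numbers the blocks of a group. A sampled item is the first of its block, and only block 0
  -- lacks one. `A` is the best lower end from sampled items up to the block of `a`, `o` the one
  -- from its own block, and `B` below the best upper end from later blocks.
  set r : Fin n → ℕ := fun a => (pos a + 1) / b with hr
  set A : Fin n → ℕ := fun a =>
    ((sample S pos b).filter fun u => γ u = γ a ∧ r u ≤ r a).sup D.lo with hA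
  set o : Fin n → ℕ := fun a =>
    ((sample S pos b).filter fun u => γ u = γ a ∧ r u = r a).sup D.lo with ho
  have hex := fun a => exists_min_bound
    ((sample S pos b).filter fun u => γ u = γ a ∧ r a < r u) D.hi D.pivots.length
  choose B hBk hBle hBex using hex
  have hoA : ∀ a, o a ≤ A a := fun a => Finset.sup_mono (fun u hu => by
    simp only [Finset.mem_filter] at hu ⊢
    exact ⟨hu.1, hu.2.1, hu.2.2.le⟩)
  have hle_o : ∀ a, ∀ u ∈ sample S pos b, γ u = γ a → r u = r a → D.lo u ≤ o a :=
    fun a u hu h1 h2 => Finset.le_sup (f := D.lo) (by simp [hu, h1, h2])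
  have hr_le : ∀ u ∈ sample S pos b, ∀ a, r u ≤ r a → pos u ≤ pos a := by
    intro u hu a hua
    simp only [sample, Finset.mem_filter] at hu
    have h1 : r u * b = pos u + 1 := Nat.div_mul_cancel hu.2
    have h2 : r a * b ≤ pos a + 1 := Nat.div_mul_le_self _ _
    have := Nat.mul_le_mul_right b hua
    omega
  have hr_lt : ∀ u a, r a < r u → pos a ≤ pos u := by
    intro u a hau
    by_contra hlt
    have : r u ≤ r a := Nat.div_le_div_right (by omega)
    omega
  have hlt_sup : ∀ (U : Finset (Fin n)) (j : ℕ), j < U.sup D.lo → ∃ u ∈ U, j < D.lo u :=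
    fun U j hj => by simpa using Finset.lt_sup_iff.1 hj
  -- Noise may make `A` exceed `B`. Clamping with `max (o a) (B a)` keeps the ranges nonempty and
  -- ties any enlargement to the item's own block.
  refine ⟨⟨D.pivots, fun a => min (A a) (max (o a) (B a)), fun a => max (o a) (B a)⟩, rfl,
    fun a ha => ⟨min_le_right _ _, ?_, ?_, ?_⟩, fun β => ?_⟩
  · refine max_le (Finset.sup_le fun u hu => ?_) (hBk a)
    have := hD u (Finset.mem_filter.1 hu).1
    exact this.1.trans this.2
  · intro j hj
    obtain ⟨u, hu, h1⟩ := hlt_sup _ j (lt_of_lt_of_le hj (min_le_left _ _))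
    simp only [Finset.mem_filter] at hu
    exact ⟨u, hu.1, hu.2.1, hr_le u hu.1 a hu.2.2, h1⟩
  · intro j hj hja
    have hBj : B a ≤ j := (le_max_right _ _).trans hja
    obtain ⟨u, hu, h1⟩ := hBex a (lt_of_le_of_lt hBj hj)
    simp only [Finset.mem_filter] at hu
    exact ⟨u, hu.1, hu.2.1, hr_lt u a hu.2.2, h1 ▸ hBj⟩
  · set T := Location.near ⟨D.pivots, fun a => min (A a) (max (o a) (B a)),
      fun a => max (o a) (B a)⟩ S β with hT
    have hTS : T ⊆ S := Finset.filter_subset _ _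
    refine (h.card_le_mul_card_image hb hTS).trans (Nat.mul_le_mul_left _ ?_)
    set block : Fin n → ℕ × ℕ := fun a => (γ a, r a) with hblock
    set own := (D.near (sample S pos b) β).image block with hown
    have hTo : ∀ a ∈ T, o a ≤ β ∧ (β ≤ B a ∨ block a ∈ own) := by
      intro a ha
      simp only [hT, Location.near, Finset.mem_filter] at ha
      have h1 : o a ≤ β := by
        rcases min_le_iff.1 ha.2.1 with h2 | h2
        · exact (hoA a).trans h2
        · exact (le_max_left _ _).trans h2
      refine ⟨h1, ?_⟩
      rcases le_or_gt β (B a) with h2 | h2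
      · exact Or.inl h2
      -- If `B a < β ≤ o a`, the sampled item of the block has lower end exactly `β`.
      · right
        have h3 : β ≤ o a := by
          rcases le_max_iff.1 ha.2.2 with h3 | h3
          · exact h3
          · omega
        obtain ⟨u, hu, h4⟩ := hlt_sup _ (β - 1) (show β - 1 < o a by omega)
        simp only [Finset.mem_filter] at hu
        have h5 := hle_o a u hu.1 hu.2.1 hu.2.2
        have h6 := (hD u hu.1).1
        refine Finset.mem_image.2 ⟨u, ?_, by simp [hblock, hu.2.1, hu.2.2]⟩
        simp only [Location.near, Finset.mem_filter]
        exact ⟨hu.1, by omega, by omega⟩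
    have hsplit : T.image block ⊆ ((T.image block) \ own) ∪ own := by
      intro z hz
      by_cases hz' : z ∈ own <;> simp [hz, hz']
    refine (Finset.card_le_card hsplit).trans ((Finset.card_union_le _ _).trans
      (Nat.add_le_add ?_ Finset.card_image_le))
    -- Each group has at most one block outside `own` that meets `T`: of two, the first item of the
    -- later one is sampled, with lower end at most `β` by its own block and upper end at least `β`
    -- by the earlier one, so it is near `β`.
    have hkey : ∀ a ∈ T, ∀ a' ∈ T, block a ∉ own → block a' ∉ own → γ a = γ a' →
        ¬ r a < r a' := by
      intro a ha a' ha' h1 h2 hγ hlt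
      obtain ⟨-, h3⟩ := hTo a ha
      have h3 := h3.resolve_right h1
      have hra : r a' * b ≤ pos a' + 1 := Nat.div_mul_le_self _ _
      have hra0 : 0 < r a' * b := Nat.mul_pos (by omega) hb
      obtain ⟨u, huS, hu1, hu2⟩ := h.surj a' (hTS ha') (r a' * b - 1) (by omega)
      have hu3 : pos u + 1 = r a' * b := by omega
      have hu : u ∈ sample S pos b := by
        simp only [sample, Finset.mem_filter]
        exact ⟨huS, hu3 ▸ Dvd.intro_left _ rfl⟩
      have hru : r u = r a' := by
        simp only [hr] at hu3 ⊢
        rw [hu3, Nat.mul_div_cancel _ hb]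
      refine h2 (Finset.mem_image.2 ⟨u, ?_, by simp [hblock, hu1, hru]⟩)
      simp only [Location.near, Finset.mem_filter]
      refine ⟨hu, (hle_o a' u hu hu1 hru).trans (hTo a' ha').1, h3.trans (hBle a u ?_)⟩
      simp [hu, hu1, hγ, hru, hlt]
    rw [← Finset.card_range G]
    refine Finset.card_le_card_of_injOn Prod.fst ?_ ?_
    · intro z hz
      simp only [Finset.coe_sdiff, Finset.coe_image, Set.mem_sdiff, Set.mem_image,
        Finset.mem_coe] at hz
      obtain ⟨⟨a, ha, rfl⟩, -⟩ := hz
      simpa using h.lt a (hTS ha)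
    · intro z hz z' hz' hzz
      simp only [Finset.coe_sdiff, Set.mem_sdiff, Finset.mem_coe] at hz hz'
      obtain ⟨hz1, hz2⟩ := hz
      obtain ⟨hz1', hz2'⟩ := hz'
      obtain ⟨a, ha, rfl⟩ := Finset.mem_image.1 hz1
      obtain ⟨a', ha', rfl⟩ := Finset.mem_image.1 hz1'
      have h1 := hkey a ha a' ha' hz2 hz2' hzz
      have h2 := hkey a' ha' a ha hz2' hz2 hzz.symm
      simp only [hblock] at hzz ⊢
      rw [hzz, le_antisymm (not_lt.1 h2) (not_lt.1 h1)]

/-! ### Iterated sampling -/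

/-- Sort each group of `S`, where every group has at most `g` items, and locate the items from a
location of the sample of every `b`-th item in each group. -/
theorem exists_refinement {b c : ℕ} (hb : 4 ≤ b) (hc : 0 < c) : ∀ (H g : ℕ) (_ : 0 < g)
    (S : Finset (Fin n)), ∃ A : Strategy n (Location n) (H + 1), ∀ x : Fin n → ℝ,
      A.Ensures x (H * (S.card * g / 2) + (S.card / b ^ H) ^ 2 / 2) fun D =>
        D.IsValid x S (2 * (H + 1)) ∧ (D.pivots.length : ℝ) * (b ^ H * c) ≤ S.card ∧
        ∀ β, ((D.near S β).card : ℝ) ≤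
          4 / 3 * (b * S.card / g) + 4 / 3 * (b ^ H - 1) + b ^ H * c
  | 0, g, _, S => by
    obtain ⟨A, hA⟩ := canSort_one n S.card S le_rfl
    refine ⟨A.map (Location.ofList c), fun x => Strategy.Ensures.map ((hA x).mono ?_ ?_)⟩
    · have : (0 : ℝ) ≤ S.card := by positivity
      norm_num
      nlinarith
    · intro l hl
      refine ⟨by simpa using Location.isValid_ofList hl zero_le_two hc, ?_, fun β => ?_⟩
      · have : l.length / c * c ≤ S.card := hl.length_eq ▸ Nat.div_mul_le_self _ _
        simp only [Location.ofList, List.length_ofFn, pow_zero, one_mul]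
        exact_mod_cast this
      · have h1 : (((Location.ofList c l).near S β).card : ℝ) ≤ c := by
          exact_mod_cast Location.card_near_ofList hl hc β
        have h2 : (0 : ℝ) ≤ 4 / 3 * (b * S.card / g) := by positivity
        simp only [pow_zero, sub_self, mul_zero, add_zero, one_mul]
        linarith
  | H + 1, g, hg, S => by
    have hb0 : 0 < b := by omega
    obtain ⟨γ, hγ, hcard⟩ := exists_grouping S hg
    set G := S.card / g + 1 with hG
    choose A hA using fun i => canSort_one n g (S.filter fun a => γ a = i)
      (by exact_mod_cast hcard i)
    choose A' hA' using exists_refinement hb hc H (g * b) (Nat.mul_pos hg hb0)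
    have : Nonempty (Location n) := ⟨⟨[], fun _ => 0, fun _ => 0⟩⟩
    let pos : (ℕ → List (Fin n)) → Fin n → ℕ := fun L a => (L (γ a)).idxOf a
    -- No mention of `x` here: the strategy must choose the new location from the answers alone.
    let good : (ℕ → List (Fin n)) → Location n → Location n → Prop := fun L D D' =>
      D'.pivots = D.pivots ∧
      (∀ a ∈ S, D'.lo a ≤ D'.hi a ∧ D'.hi a ≤ D'.pivots.length ∧
        (∀ j < D'.lo a, ∃ u ∈ sample S (pos L) b,
          γ u = γ a ∧ pos L u ≤ pos L a ∧ j < D.lo u) ∧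
        (∀ j < D'.pivots.length, D'.hi a ≤ j →
          ∃ u ∈ sample S (pos L) b, γ u = γ a ∧ pos L a ≤ pos L u ∧ D.hi u ≤ j)) ∧
      ∀ β, (D'.near S β).card ≤ b * (G + (D.near (sample S (pos L) b) β).card)
    refine ⟨(Strategy.par (Finset.range G) A).bind fun L =>
      (A' (sample S (pos L) b)).map fun D => Classical.epsilon (good L D), fun x => ?_⟩
    have hpar := Strategy.Ensures.par (I := Finset.range G) fun i _ => hA i x
    set s : ℝ := (S.card : ℝ) with hs
    have hs0 : 0 ≤ s := by positivity
    have hbR : (4 : ℝ) ≤ b := by exact_mod_cast hb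
    have hgR : (0 : ℝ) < g := by exact_mod_cast hg
    have hsum : ∑ i ∈ Finset.range G, ((g : ℝ) - 1) / 2 * (S.filter fun a => γ a = i).card =
        (g - 1) / 2 * s := by
      rw [← Finset.mul_sum, hs, Finset.card_eq_sum_card_fiberwise (f := γ) (s := S)
        (t := Finset.range G) (fun a ha => by simpa using hγ a ha)]
      push_cast
      rfl
    refine (hpar.bind (c' := H * (s * g / 2) + (s / b ^ (H + 1)) ^ 2 / 2)
      fun L hL => Strategy.Ensures.map ?_).mono ?_ fun _ => id
    · have hL' : ∀ a ∈ S, IsOrdering x (S.filter fun a' => γ a' = γ a) 2 (L (γ a)) :=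
        fun a ha => hL _ (Finset.mem_range.2 (hγ a ha))
      have hmem : ∀ a ∈ S, a ∈ L (γ a) := fun a ha => ((hL' a ha).mem_iff a).2 (by simp [ha])
      have hgr : IsGrouped S γ (pos L) G := by
        refine ⟨hγ, fun a ha a' _ h1 h2 => ?_, fun a ha m hm => ?_⟩
        · simp only [pos, ← h1] at h2
          exact (List.idxOf_inj (hmem a ha)).1 h2
        · have hm' : m < (L (γ a)).length :=
            lt_of_le_of_lt hm (List.idxOf_lt_length_of_mem (hmem a ha))
          have h1 := ((hL' a ha).mem_iff _).1 (List.getElem_mem hm')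
          rw [Finset.mem_filter] at h1
          refine ⟨_, h1.1, h1.2, ?_⟩
          simp only [pos, h1.2]
          exact (hL' a ha).nodup.idxOf_getElem _ _
      have hord : ∀ a ∈ S, ∀ a' ∈ S, γ a = γ a' → pos L a ≤ pos L a' → x a ≤ x a' + 2 := by
        intro a ha a' ha' h1 h2
        simp only [pos, ← h1] at h2
        exact (hL' a ha).le_of_idxOf_le zero_le_two (by simp [ha]) (by simp [ha', h1]) h2
      have hsS : sample S (pos L) b ⊆ S := Finset.filter_subset _ _
      have hs' : ((sample S (pos L) b).card : ℝ) * b ≤ s := by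
        rw [hs]; exact_mod_cast hgr.card_sample_mul_le b
      set s' : ℝ := ((sample S (pos L) b).card : ℝ) with hs'def
      have hs'0 : 0 ≤ s' := by positivity
      have hs'b : s' ≤ s / b := (le_div_iff₀ (by linarith)).2 hs'
      -- The sample is `b` times smaller and its groups are `b` times larger, so the cost per level
      -- does not grow.
      refine (hA' (sample S (pos L) b) x).mono ?_ ?_
      · have h1 : s' / b ^ H ≤ s / b ^ (H + 1) := by
          rw [pow_succ', ← div_div]
          gcongr
        push_cast
        rw [← hs'def]
        gcongr ?_ * (?_ / 2) + ?_ ^ 2 / 2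
        nlinarith
      · rintro D ⟨hD1, hD2, hD3⟩
        have hspec : good L D (Classical.epsilon (good L D)) := Classical.epsilon_spec
          (hgr.exists_location hb0 D fun u hu => ⟨hD1.lo_le_hi u hu, hD1.hi_le u hu⟩)
        generalize Classical.epsilon (good L D) = D' at hspec ⊢
        obtain ⟨h1, h2, h3⟩ := hspec
        refine ⟨⟨fun a ha => (h2 a ha).1, fun a ha => (h2 a ha).2.1, fun a ha j hj hja => ?_,
          fun a ha j hj hja => ?_⟩, ?_, fun β => ?_⟩
        · obtain ⟨u, hu, h4, h5, h6⟩ := (h2 a ha).2.2.1 j hja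
          have h7 := hD1.pivot_le u hu j (h1 ▸ hj) h6
          have h8 := hord u (hsS hu) a ha h4 h5
          simp only [h1]
          push_cast
          linarith
        · obtain ⟨u, hu, h4, h5, h6⟩ := (h2 a ha).2.2.2 j hj hja
          have h7 := hD1.le_pivot u hu j (h1 ▸ hj) h6
          have h8 := hord a ha u (hsS hu) h4.symm h5
          simp only [h1]
          push_cast
          linarith
        · rw [h1, pow_succ]
          rw [← hs'def] at hD2
          nlinarith
        · have h4 : ((D'.near S β).card : ℝ) ≤
              b * (G + ((D.near (sample S (pos L) b) β).card : ℝ)) := by exact_mod_cast h3 β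
          have h5 := hD3 β
          have h6 : (G : ℝ) ≤ s / g + 1 := by
            rw [hG]
            push_cast
            gcongr
            exact Nat.cast_div_le
          have h7 : (b : ℝ) * s' / ((g * b : ℕ) : ℝ) = s' / g := by
            push_cast
            field_simp
          rw [← hs'def, h7] at h5
          have h8 : b * (s' / g) ≤ s / g := by
            rw [← mul_div_assoc]
            gcongr
            linarith
          have h9 : 0 ≤ s / g := by positivity
          have h10 : (b : ℝ) * (G + ((D.near (sample S (pos L) b) β).card : ℝ)) ≤
              b * (s / g + 1 + (4 / 3 * (s' / g) + 4 / 3 * (b ^ H - 1) + b ^ H * c)) := by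
            gcongr
          -- This is where `4 ≤ b` matters: the contributions of the levels form a geometric series
          -- with ratio at most 1/4, whence the factor 4/3.
          have h11 : (4 : ℝ) / 3 * (s / g) ≤ b / 3 * (s / g) := by gcongr
          have h12 : (b : ℝ) * s / g = b * (s / g) := by ring
          rw [h12, pow_succ']
          linarith
    · have h1 : ((g : ℝ) - 1) / 2 * s ≤ s * g / 2 := by nlinarith
      calc _ = ((g : ℝ) - 1) / 2 * s + (H * (s * g / 2) + (s / b ^ (H + 1)) ^ 2 / 2) := by
            rw [← hsum]
        _ ≤ s * g / 2 + (H * (s * g / 2) + (s / b ^ (H + 1)) ^ 2 / 2) := by gcongr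
        _ = _ := by push_cast; ring

/-! ### Distribution into buckets -/

/-- The comparisons of the items in `S` with the pivots in their ranges. -/
def Location.queries (D : Location n) (S : Finset (Fin n)) : Finset (Query n) :=
  S.biUnion fun a => (Finset.Ico (D.lo a) (D.hi a)).image fun j => (a, D.pivots.getD j a)

/-- The number of pivots that are put below `a` after the comparisons in `w`. -/
def Location.bucket (D : Location n) (w : Query n → Fin n) (a : Fin n) : ℕ :=
  max (D.lo a) (((Finset.Ico (D.lo a) (D.hi a)).filter fun j =>
    w (a, D.pivots.getD j a) = a).sup fun j => j + 1)

/-- Double counting: pivot `j` is compared only with items whose range contains `j`. -/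
theorem Location.IsValid.card_queries_le {D : Location n} {x : Fin n → ℝ}
    {S : Finset (Fin n)} {e : ℝ} (h : D.IsValid x S e) {T : ℝ}
    (hT : ∀ β, ((D.near S β).card : ℝ) ≤ T) :
    ((D.queries S).card : ℝ) ≤ D.pivots.length * T := by
  have h1 : (D.queries S).card ≤ ∑ j ∈ Finset.range D.pivots.length, (D.near S j).card := by
    calc (D.queries S).card ≤ ∑ a ∈ S, (Finset.Ico (D.lo a) (D.hi a)).card :=
          Finset.card_biUnion_le.trans (Finset.sum_le_sum fun a _ => Finset.card_image_le)
      _ ≤ ∑ a ∈ S, ((Finset.range D.pivots.length).filter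
            fun j => D.lo a ≤ j ∧ j ≤ D.hi a).card := by
          refine Finset.sum_le_sum fun a ha => Finset.card_le_card fun j hj => ?_
          have := h.hi_le a ha
          simp only [Finset.mem_Ico, Finset.mem_filter, Finset.mem_range] at hj ⊢
          omega
      _ = _ := Finset.sum_card_bipartiteAbove_eq_sum_card_bipartiteBelow
          fun a j => D.lo a ≤ j ∧ j ≤ D.hi a
  calc ((D.queries S).card : ℝ) ≤ ∑ j ∈ Finset.range D.pivots.length,
        ((D.near S j).card : ℝ) := by exact_mod_cast h1
    _ ≤ ∑ j ∈ Finset.range D.pivots.length, T := Finset.sum_le_sum fun j _ => hT j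
    _ = _ := by simp

theorem Location.IsValid.bucket_mem {D : Location n} {x : Fin n → ℝ}
    {S : Finset (Fin n)} {e : ℝ} (h : D.IsValid x S e) (w : Query n → Fin n) {a : Fin n}
    (ha : a ∈ S) : D.lo a ≤ D.bucket w a ∧ D.bucket w a ≤ D.hi a := by
  refine ⟨le_max_left _ _, max_le (h.lo_le_hi a ha) (Finset.sup_le fun j hj => ?_)⟩
  simp only [Finset.mem_filter, Finset.mem_Ico] at hj
  omega

/-- A pivot separates the two items: the last one put below `a'` is not put below `a`. Each side
errs by at most `e`, since `1 ≤ e` also covers a direct comparison. -/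
theorem Location.IsValid.le_of_bucket_lt {D : Location n} {x : Fin n → ℝ}
    {S : Finset (Fin n)} {e : ℝ} (h : D.IsValid x S e) (he : 1 ≤ e) {w : Query n → Fin n}
    (hw : ∀ q ∈ D.queries S, IsPossibleAnswer x q.1 q.2 (w q)) {a a' : Fin n} (ha : a ∈ S)
    (ha' : a' ∈ S) (hlt : D.bucket w a < D.bucket w a') : x a ≤ x a' + 2 * e := by
  have hq : ∀ u ∈ S, ∀ j, (hj : j < D.pivots.length) → D.lo u ≤ j → j < D.hi u →
      D.pivots.getD j u = D.pivots[j] ∧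
        IsPossibleAnswer x u D.pivots[j] (w (u, D.pivots[j])) := by
    intro u hu j hj h1 h2
    have h3 : D.pivots.getD j u = D.pivots[j] := List.getD_eq_getElem _ _ hj
    refine ⟨h3, hw (u, D.pivots[j]) ?_⟩
    refine Finset.mem_biUnion.2 ⟨u, hu, Finset.mem_image.2 ⟨j, by simp [h1, h2], ?_⟩⟩
    rw [h3]
  obtain ⟨j, hj, hja, hja'⟩ : ∃ j, ∃ hj : j < D.pivots.length, D.bucket w a ≤ j ∧
      x D.pivots[j] ≤ x a' + e := by
    rcases lt_max_iff.1 hlt with h1 | h1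
    · have := (h.lo_le_hi a' ha').trans (h.hi_le a' ha')
      exact ⟨D.bucket w a, by omega, le_rfl, h.pivot_le a' ha' _ _ h1⟩
    · obtain ⟨j, hj, h2⟩ := Finset.lt_sup_iff.1 h1
      simp only [Finset.mem_filter, Finset.mem_Ico] at hj
      have hj' : j < D.pivots.length := lt_of_lt_of_le hj.1.2 (h.hi_le a' ha')
      obtain ⟨h3, h4⟩ := hq a' ha' j hj' hj.1.1 hj.1.2
      have h5 := hj.2
      rw [h3] at h5
      rw [h5] at h4
      exact ⟨j, hj', by omega, h4.le_of_fst.trans (by linarith)⟩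
  have hlo := (h.bucket_mem w ha).1
  have hxa : x a ≤ x D.pivots[j] + e := by
    rcases le_or_gt (D.hi a) j with h1 | h1
    · exact h.le_pivot a ha j hj h1
    · obtain ⟨h3, h4⟩ := hq a ha j hj (hlo.trans hja) h1
      rcases h4.1 with h5 | h5
      · have h6 : j + 1 ≤ D.bucket w a := le_max_of_le_right
          (Finset.le_sup (f := fun j => j + 1) (by
            simp only [Finset.mem_filter, Finset.mem_Ico]
            exact ⟨⟨hlo.trans hja, h1⟩, by rw [h3, h5]⟩))
        omega
      · rw [h5] at h4
        linarith [h4.le_of_snd]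
  linarith

theorem isOrdering_flatMap {x : Fin n → ℝ} {S : Finset (Fin n)} {k : ℝ} {m : ℕ}
    {f : Fin n → ℕ} {L : ℕ → List (Fin n)} (hf : ∀ a ∈ S, f a < m)
    (hL : ∀ i < m, IsOrdering x (S.filter fun a => f a = i) k (L i))
    (hlt : ∀ a ∈ S, ∀ b ∈ S, f a < f b → x a ≤ x b + k) :
    IsOrdering x S k ((List.range m).flatMap L) := by
  have hmem : ∀ i ∈ List.range m, ∀ a, a ∈ L i ↔ a ∈ S ∧ f a = i := fun i hi a => by
    rw [(hL i (List.mem_range.1 hi)).mem_iff a, Finset.mem_filter]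
  refine ⟨?_, fun a => ?_, ?_⟩
  · refine List.nodup_flatMap.2 ⟨fun i hi => (hL i (List.mem_range.1 hi)).nodup, ?_⟩
    refine List.Pairwise.imp_of_mem ?_ (List.pairwise_lt_range (n := m))
    intro i j hi hj hij a hai haj
    have h1 := (hmem i hi a).1 hai
    have h2 := (hmem j hj a).1 haj
    omega
  · rw [List.mem_flatMap]
    constructor
    · rintro ⟨i, hi, ha⟩
      exact ((hmem i hi a).1 ha).1
    · intro ha
      have := List.mem_range.2 (hf a ha)
      exact ⟨_, this, (hmem _ this a).2 ⟨ha, rfl⟩⟩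
  · refine List.pairwise_flatMap.2 ⟨fun i hi => (hL i (List.mem_range.1 hi)).pairwise, ?_⟩
    refine List.Pairwise.imp_of_mem ?_ (List.pairwise_lt_range (n := m))
    intro i j hi hj hij a ha b hb
    obtain ⟨h1, rfl⟩ := (hmem i hi a).1 ha
    obtain ⟨h2, rfl⟩ := (hmem j hj b).1 hb
    exact hlt a h1 b h2 hij

/-! ### Recursion on the number of items -/

/-- Reduce the problem of sorting `N` items to that of sorting `N'` items. -/
theorem CanSort.step {R H b c g : ℕ} {N N' C C' k : ℝ} (h : CanSort n R N' C' k)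
    (hb : 4 ≤ b) (hc : 0 < c) (hg : 0 < g) (hk : 4 * (H + 1) ≤ k)
    (hN : 4 / 3 * (b * N / g) + 4 / 3 * (b ^ H - 1) + b ^ H * c ≤ N')
    (hC : H * (g / 2) + N / (b ^ H) ^ 2 / 2 + N' / (b ^ H * c) + C' ≤ C) :
    CanSort n (R + 1 + (H + 1)) N C k := by
  intro S hS
  obtain ⟨A, hA⟩ := exists_refinement hb hc H g hg S
  set s : ℝ := (S.card : ℝ) with hs
  have hs0 : 0 ≤ s := by positivity
  have hbR : (4 : ℝ) ≤ b := by exact_mod_cast hb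
  have hcR : (0 : ℝ) < c := by exact_mod_cast hc
  have hN'0 : 0 ≤ N' := by
    refine le_trans ?_ hN
    have h1 : (1 : ℝ) ≤ b ^ H := one_le_pow₀ (by linarith)
    have h2 : 0 ≤ N := hs0.trans hS
    have h3 : (0 : ℝ) ≤ 4 / 3 * (b ^ H - 1) := by linarith
    positivity
  -- Oversized sets receive an irrelevant default, so that `place` is defined for all answers.
  have hex : ∀ U : Finset (Fin n), ∃ B : Strategy n (List (Fin n)) R, (U.card : ℝ) ≤ N' →
      ∀ x : Fin n → ℝ, B.Ensures x (C' * U.card) (IsOrdering x U k) := by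
    intro U
    by_cases hU : (U.card : ℝ) ≤ N'
    · obtain ⟨B, hB⟩ := h U hU
      exact ⟨B, fun _ => hB⟩
    · obtain ⟨B, -⟩ := h ∅ (by simpa using hN'0)
      exact ⟨B, fun h => absurd h hU⟩
  choose B hB using hex
  let place : Location n → Strategy n (List (Fin n)) (R + 1) := fun D =>
    (D.queries S, fun w => (Strategy.par (Finset.range (D.pivots.length + 1)) fun β =>
      B (S.filter fun a => D.bucket w a = β)).map
        fun L => (List.range (D.pivots.length + 1)).flatMap L)
  refine ⟨A.bind place, fun x => ?_⟩
  refine ((hA x).bind (c' := s * (N' / (b ^ H * c)) + C' * s) (f := place) ?_).mono ?_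
    fun _ => id
  · rintro D ⟨hD1, hD2, hD3⟩ w hw
    have hT : ∀ β, ((D.near S β).card : ℝ) ≤ N' := fun β => by
      refine (hD3 β).trans (le_trans ?_ hN)
      gcongr
    have hbk : ∀ a ∈ S, D.bucket w a < D.pivots.length + 1 := fun a ha =>
      Nat.lt_succ_of_le ((hD1.bucket_mem w ha).2.trans (hD1.hi_le a ha))
    refine Strategy.Ensures.map ((Strategy.Ensures.par fun β _ => hB _ ?_ x).mono ?_ ?_)
    -- An item's bucket number lies in its range, so the bucket consists of items near `β`.
    · refine le_trans ?_ (hT β)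
      exact_mod_cast Finset.card_le_card fun a ha => by
        simp only [Location.near, Finset.mem_filter] at ha ⊢
        exact ⟨ha.1, ha.2 ▸ hD1.bucket_mem w ha.1⟩
    · have h1 : ∑ β ∈ Finset.range (D.pivots.length + 1),
          C' * ((S.filter fun a => D.bucket w a = β).card : ℝ) = C' * s := by
        rw [← Finset.mul_sum, hs, Finset.card_eq_sum_card_fiberwise (f := D.bucket w) (s := S)
          (t := Finset.range (D.pivots.length + 1)) (fun a ha => by simpa using hbk a ha)]
        push_cast
        rfl
      have h2 : ((D.queries S).card : ℝ) ≤ s * (N' / (b ^ H * c)) := by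
        refine (hD1.card_queries_le hT).trans ?_
        have h3 : (D.pivots.length : ℝ) ≤ s / (b ^ H * c) :=
          (le_div_iff₀ (by positivity)).2 hD2
        calc (D.pivots.length : ℝ) * N' ≤ s / (b ^ H * c) * N' := by gcongr
          _ = _ := by ring
      rw [h1]
      simp only [place]
      linarith
    · intro L hL
      refine isOrdering_flatMap hbk (fun i hi => hL i (Finset.mem_range.2 hi)) ?_
      intro a ha a' ha' hlt
      have := hD1.le_of_bucket_lt (by have : (0 : ℝ) ≤ H := by positivity
                                      linarith) hw ha ha' hlt
      linarith
  · have h1 : (s / b ^ H) ^ 2 / 2 ≤ s * (N / (b ^ H) ^ 2 / 2) := by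
      rw [div_pow, sq s]
      have : s * s / (b ^ H : ℝ) ^ 2 / 2 = s * (s / (b ^ H) ^ 2 / 2) := by ring
      rw [this]
      gcongr
    have h2 := mul_le_mul_of_nonneg_right hC hs0
    linarith

theorem canSort_pow {n q : ℕ} (hq : 4 ≤ q) : ∀ t : ℕ, CanSort n ((t + 1) ^ 2) (q ^ (t + 2))
    ((t ^ 2 / 2 + 15 * t / 8 + 1 / 2) * q ^ 2) (2 * (t + 1) ^ 2)
  | 0 => by
    refine (canSort_one n _).mono le_rfl ?_ (by norm_num)
    norm_num
    linarith
  | t + 1 => by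
    have hqR : (4 : ℝ) ≤ q := by exact_mod_cast hq
    have hq0 : (0 : ℝ) < q := by linarith
    -- About half of the exponent: then the complete comparison of the last sample costs at most `q
    -- ^ 2 / 2` per item.
    obtain ⟨H, hH⟩ : ∃ H, H = (t + 2) / 2 := ⟨_, rfl⟩
    have hHR : (H : ℝ) ≤ (t + 2) / 2 := by
      rw [hH]
      exact_mod_cast (Nat.cast_div_le (α := ℝ) (m := t + 2) (n := 2))
    have ht0 : (0 : ℝ) ≤ t := t.cast_nonneg
    have hHt : H ≤ t + 1 := by omega
    have hpow : (q : ℝ) ^ H * ((q ^ (t + 1 - H) : ℕ) : ℝ) = q ^ (t + 1) := by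
      push_cast
      rw [← pow_add, Nat.add_sub_cancel' hHt]
    have hstep := ((canSort_pow (n := n) hq t).mono le_rfl le_rfl
      (k' := 2 * ((t + 1 : ℕ) + 1) ^ 2) (by push_cast; gcongr; linarith)).step
      (R := (t + 1) ^ 2) (H := H) (b := q) (c := q ^ (t + 1 - H)) (g := 4 * q ^ 2)
      (N := q ^ (t + 1 + 2))
      (C := (((t + 1 : ℕ) : ℝ) ^ 2 / 2 + 15 * (t + 1 : ℕ) / 8 + 1 / 2) * q ^ 2)
      hq (by positivity) (by positivity) (by push_cast; nlinarith) ?_ ?_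
    · refine hstep.mono ?_ le_rfl le_rfl
      have : H ≤ 2 * t + 1 := by omega
      nlinarith
    -- With `g = 4 * q ^ 2` and `4 ≤ q`, the three terms are at most 1/3, 1/3 and 1/4 of `q ^ (t +
    -- 2)`.
    · rw [hpow]
      have h1 : (q : ℝ) * q ^ (t + 1 + 2) / ((4 * q ^ 2 : ℕ) : ℝ) = q * q ^ (t + 1) / 4 := by
        push_cast
        field_simp
        ring
      have h2 : (q : ℝ) ^ H ≤ q ^ (t + 1) := pow_le_pow_right₀ (by linarith) hHt
      have h3 : (q : ℝ) ^ (t + 2) = q * q ^ (t + 1) := by ring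
      have h4 : 4 * (q : ℝ) ^ (t + 1) ≤ q * q ^ (t + 1) := by gcongr
      have h5 : (0 : ℝ) < q ^ (t + 1) := by positivity
      rw [h1, h3]
      linarith
    · rw [hpow]
      have h1 : (q : ℝ) ^ (t + 2) / q ^ (t + 1) = q := by
        rw [pow_succ (q : ℝ) (t + 1)]
        field_simp
      have h2 : 4 * (q : ℝ) ≤ q ^ 2 := by nlinarith
      rw [h1]
      push_cast
      -- The even case is the tight one: its cost `(t + 2) * q ^ 2 + 3 * q / 2` is at most `(t + 19
      -- / 8) * q ^ 2`, exactly the increment of the bound, which explains the coefficient 15/8.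
      rcases Nat.even_or_odd' t with ⟨m, hm | hm⟩
      · have h3 : H = m + 1 := by omega
        have h4 : (q : ℝ) ^ (t + 1 + 2) / (q ^ H) ^ 2 = q := by
          rw [← pow_mul, show t + 1 + 2 = H * 2 + 1 by omega, pow_succ]
          field_simp
        have h5 : (H : ℝ) = t / 2 + 1 := by
          rw [h3, hm]; push_cast; ring
        rw [h4, h5]
        nlinarith
      · have h3 : H = m + 1 := by omega
        have h4 : (q : ℝ) ^ (t + 1 + 2) / (q ^ H) ^ 2 = q ^ 2 := by
          rw [← pow_mul, show t + 1 + 2 = H * 2 + 2 by omega, pow_add]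
          field_simp
        have h5 : (H : ℝ) = t / 2 + 1 / 2 := by
          rw [h3, hm]; push_cast; ring
        rw [h4, h5]
        nlinarith

/-! ### Permutations and choice of parameters -/

open Classical in
/-- The permutation listed by `l`, if `l` lists every item exactly once. -/
noncomputable def listPerm {n : ℕ} (l : List (Fin n)) : Equiv.Perm (Fin n) :=
  if h : l.Nodup ∧ ∀ a, a ∈ l then
    (finCongr (by
      have huniv : l.toFinset = Finset.univ := by
        ext a
        simp [h.2]
      rw [← List.toFinset_card_of_nodup h.1, huniv, Finset.card_fin])).trans
      (h.1.getEquivOfForallMemList l h.2)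
  else 1

theorem IsOrdering.isApproxSorting {n : ℕ} {x : Fin n → ℝ} {k : ℝ} {l : List (Fin n)}
    (h : IsOrdering x Finset.univ k l) : IsApproxSorting x k (listPerm l) := by
  have hl : l.Nodup ∧ ∀ a, a ∈ l := ⟨h.nodup, fun a => (h.mem_iff a).2 (Finset.mem_univ a)⟩
  have hlen : l.length = n := h.length_eq.trans (Finset.card_fin n)
  intro p q hpq
  have := List.pairwise_iff_getElem.1 h.pairwise p q (hlen.symm ▸ p.2) (hlen.symm ▸ q.2) hpq
  simp only [listPerm, dif_pos hl]
  simp only [Equiv.trans_apply, finCongr_apply, List.Nodup.getEquivOfForallMemList_apply,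
    List.get_eq_getElem, Fin.val_cast]
  linarith

theorem CanSort.exists_algorithm {n R d : ℕ} {N c k K : ℝ} (h : CanSort n R N c k)
    (hN : n ≤ N) (hR : R ≤ d) (hk : k ≤ K) :
    ∃ A : RoundAlgorithm n d, ∀ (x : Fin n → ℝ) (C : AdaptiveComparator x),
      (A.comparisons C : ℝ) ≤ c * n ∧ IsApproxSorting x K (A.output C) := by
  obtain ⟨A, hA⟩ := h.mono hR le_rfl hk Finset.univ (by simpa using hN)
  refine ⟨(A.map listPerm).toAlgorithm, fun x C => ?_⟩
  have := Strategy.Ensures.map (f := listPerm) (Q := IsApproxSorting x K)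
    ((hA x).mono le_rfl fun l hl => hl.isApproxSorting)
  rw [Finset.card_fin] at this
  exact this.toAlgorithm C []

/-- Square `e * u ≤ exp u` at `u = log n / √d`. The lower bound no longer depends on `d`, which
serves when `n` is too small to need all the rounds. -/
theorem sq_exp_mul_log_le {n d : ℝ} (hn : 1 ≤ n) (hd : 0 < d) :
    (Real.exp 1 * Real.log n) ^ 2 ≤ d * n ^ (2 / √d) := by
  have hs : 0 < √d := Real.sqrt_pos.2 hd
  have hlog : 0 ≤ Real.log n := Real.log_nonneg hn
  have h1 : Real.exp 1 * (Real.log n / √d) ≤ Real.exp (Real.log n / √d) := by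
    have := Real.add_one_le_exp (Real.log n / √d - 1)
    calc _ ≤ Real.exp 1 * Real.exp (Real.log n / √d - 1) := by gcongr; linarith
      _ = _ := by rw [← Real.exp_add]; ring_nf
  have h2 : n ^ (2 / √d) = Real.exp (Real.log n / √d) ^ 2 := by
    rw [Real.rpow_def_of_pos (by linarith), ← Real.exp_nat_mul]
    congr 1
    push_cast
    ring
  have h3 : (Real.exp 1 * Real.log n) ^ 2 = d * (Real.exp 1 * (Real.log n / √d)) ^ 2 := by
    have := Real.sq_sqrt hd.le
    field_simp
    rw [this]
  rw [h2, h3]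
  gcongr

theorem exists_canSort {n d : ℕ} (hd : 0 < d) (hn : 0 < n) :
    ∃ (R : ℕ) (N c k : ℝ), CanSort n R N c k ∧ n ≤ N ∧ R ≤ d ∧ k ≤ 2 * d ∧
      c ≤ d * (n : ℝ) ^ (2 / √(d : ℝ)) := by
  have hnR : (1 : ℝ) ≤ n := by exact_mod_cast hn
  have hdR : (1 : ℝ) ≤ d := by exact_mod_cast hd
  have hs : 0 < √(d : ℝ) := Real.sqrt_pos.2 (by linarith)
  have hpow1 : 1 ≤ (n : ℝ) ^ (2 / √(d : ℝ)) := Real.one_le_rpow hnR (by positivity)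
  -- For `d ≤ 4` the exponent `2 / √d` is at least 1, so all pairs are affordable.
  rcases le_or_gt d 4 with hd4 | hd4
  · refine ⟨1, n, _, 2, canSort_one n n, le_rfl, hd, by linarith, ?_⟩
    have h1 : √(d : ℝ) ≤ 2 := Real.sqrt_le_iff.2 ⟨by norm_num, by
      have : (d : ℝ) ≤ 4 := by exact_mod_cast hd4
      linarith⟩
    have h2 : (n : ℝ) ^ (1 : ℝ) ≤ (n : ℝ) ^ (2 / √(d : ℝ)) :=
      Real.rpow_le_rpow_of_exponent_le hnR ((one_le_div hs).2 h1)
    rw [Real.rpow_one] at h2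
    nlinarith
  have hd5 : (5 : ℝ) ≤ d := by exact_mod_cast hd4
  obtain ⟨m, hm⟩ : ∃ m, m = ⌈√(d : ℝ)⌉₊ := ⟨_, rfl⟩
  have hm1 : √(d : ℝ) ≤ m := hm ▸ Nat.le_ceil _
  have hm2 : (m : ℝ) < √(d : ℝ) + 1 := hm ▸ Nat.ceil_lt_add_one hs.le
  have hsq := Real.sq_sqrt (show (0 : ℝ) ≤ d by linarith)
  have hm3 : 2 ≤ m := by
    have : (1 : ℝ) < m := lt_of_lt_of_le (by nlinarith) hm1
    exact_mod_cast this
  obtain ⟨s, rfl⟩ := Nat.exists_eq_add_of_le' hm3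
  push_cast at hm1 hm2
  have hs1 : (s + 1) ^ 2 < d := by
    have : ((s : ℝ) + 1) ^ 2 < d := by
      have : (0 : ℝ) ≤ s := s.cast_nonneg
      nlinarith
    exact_mod_cast this
  have hround : ∀ t ≤ s, (t + 1) ^ 2 ≤ d ∧ 2 * ((t : ℝ) + 1) ^ 2 ≤ 2 * d := by
    intro t ht
    have : (t + 1) ^ 2 ≤ d := (Nat.pow_le_pow_left (by omega) 2).trans hs1.le
    refine ⟨this, ?_⟩
    have : ((t : ℝ) + 1) ^ 2 ≤ d := by exact_mod_cast this
    linarith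
  -- For small `n`, keep `q = 4` and shorten the recursion; otherwise use its full depth and the
  -- least sufficient `q`.
  rcases le_or_gt n (4 ^ (s + 2)) with h4 | h4
  · have hex : ∃ p, n ≤ 4 ^ p := ⟨_, h4⟩
    obtain ⟨p, hp⟩ : ∃ p, p = Nat.find hex := ⟨_, rfl⟩
    have hp1 : n ≤ 4 ^ p := hp ▸ Nat.find_spec hex
    have hp2 : p ≤ s + 2 := hp ▸ Nat.find_min' hex h4
    rcases le_or_gt p 1 with hp3 | hp3
    · have hn4 : n ≤ 4 := 
        hp1.trans (by simpa using Nat.pow_le_pow_right (show 0 < 4 by norm_num) hp3)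
      refine ⟨1, 4, _, 2, canSort_one n 4, by exact_mod_cast hn4, hd, by linarith, ?_⟩
      nlinarith
    · obtain ⟨t, rfl⟩ := Nat.exists_eq_add_of_le' (show 2 ≤ p from hp3)
      have hp4 : 4 ^ (t + 1) < n := not_le.1 (Nat.find_min hex (hp ▸ Nat.lt_succ_self _))
      obtain ⟨h1, h2⟩ := hround t (by omega)
      refine ⟨_, _, _, _, canSort_pow (q := 4) le_rfl t, by exact_mod_cast hp1, h1, h2,
        le_trans ?_ (sq_exp_mul_log_le hnR (by linarith))⟩
      have ht0 : (0 : ℝ) ≤ t := t.cast_nonneg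
      have hlog : (t + 1) * (2 * Real.log 2) ≤ Real.log n := by
        have h3 : Real.log ((4 : ℝ) ^ (t + 1)) ≤ Real.log n :=
          Real.log_le_log (by positivity) (by exact_mod_cast hp4.le)
        rw [Real.log_pow, show (4 : ℝ) = 2 ^ 2 by norm_num, Real.log_pow] at h3
        push_cast at h3
        exact h3
      have hl2 := Real.log_two_gt_d9
      have he := Real.exp_one_gt_d9
      -- 3.767 is just below `2 * e * log 2`, and its square times `(t + 1) ^ 2` dominates the cost
      -- `8 * t ^ 2 + 30 * t + 8` for `q = 4`.
      have h5 : 3.767 * ((t : ℝ) + 1) ≤ Real.exp 1 * Real.log n := by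
        calc 3.767 * ((t : ℝ) + 1) ≤ 2.718 * ((t + 1) * (2 * 0.693)) := by nlinarith
          _ ≤ Real.exp 1 * ((t + 1) * (2 * Real.log 2)) := by gcongr <;> linarith
          _ ≤ _ := by gcongr
      calc _ ≤ (3.767 * ((t : ℝ) + 1)) ^ 2 := by
            push_cast
            nlinarith [sq_nonneg ((t : ℝ) - 1)]
        _ ≤ _ := by gcongr
  · have hex : ∃ q, n ≤ q ^ (s + 2) := ⟨n, Nat.le_self_pow (by omega) n⟩
    obtain ⟨q, hq⟩ : ∃ q, q = Nat.find hex := ⟨_, rfl⟩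
    have hq1 : n ≤ q ^ (s + 2) := hq ▸ Nat.find_spec hex
    have hq2 : 5 ≤ q := by
      by_contra hlt
      have := Nat.pow_le_pow_left (show q ≤ 4 by omega) (s + 2)
      omega
    obtain ⟨r, rfl⟩ := Nat.exists_eq_add_of_le' (show 1 ≤ q by omega)
    have hr : r ^ (s + 2) < n := not_le.1 (Nat.find_min hex (hq ▸ Nat.lt_succ_self _))
    have hrR : (4 : ℝ) ≤ r := by exact_mod_cast (show 4 ≤ r by omega)
    obtain ⟨h1, h2⟩ := hround s le_rfl
    refine ⟨_, _, _, _, canSort_pow (q := r + 1) (by omega) s, by exact_mod_cast hq1, h1, h2, ?_⟩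
    have hs0 : (0 : ℝ) ≤ s := s.cast_nonneg
    have h3 : (r : ℝ) ^ 2 ≤ (n : ℝ) ^ (2 / √(d : ℝ)) := by
      calc (r : ℝ) ^ 2 = ((r : ℝ) ^ (s + 2)) ^ (2 / ((s : ℝ) + 2)) := by
            rw [← Real.rpow_natCast, ← Real.rpow_natCast, ← Real.rpow_mul (by linarith)]
            congr 1
            push_cast
            field_simp
        _ ≤ (n : ℝ) ^ (2 / ((s : ℝ) + 2)) := by
            gcongr
            exact_mod_cast hr.le
        _ ≤ _ := Real.rpow_le_rpow_of_exponent_le hnR (by gcongr)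
    have hdR' : ((s : ℝ) + 1) ^ 2 + 1 ≤ d := by exact_mod_cast hs1
    -- 25/16 pays for rounding `r` up to `r + 1 ≤ 5 / 4 * r`. The quadratic inequality in `s` needs
    -- the extra 1 in `(s + 1) ^ 2 + 1 ≤ d`; its minimum is at 2.125.
    have h4 : 25 / 16 * ((s : ℝ) ^ 2 / 2 + 15 * s / 8 + 1 / 2) ≤ d := by
      nlinarith [sq_nonneg ((s : ℝ) - 2.125)]
    have h5 : ((r + 1 : ℕ) : ℝ) ^ 2 ≤ (5 / 4 * (r : ℝ)) ^ 2 := by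
      push_cast
      gcongr
      linarith
    calc ((s : ℝ) ^ 2 / 2 + 15 * s / 8 + 1 / 2) * ((r + 1 : ℕ) : ℝ) ^ 2
        ≤ ((s : ℝ) ^ 2 / 2 + 15 * s / 8 + 1 / 2) * (5 / 4 * (r : ℝ)) ^ 2 := by gcongr
      _ = (25 / 16 * ((s : ℝ) ^ 2 / 2 + 15 * s / 8 + 1 / 2)) * (r : ℝ) ^ 2 := by ring
      _ ≤ d * (r : ℝ) ^ 2 := by gcongr
      _ ≤ _ := by gcongr

end ImpreciseSorting

theorem theorem1p4 (d : ℕ) (hd : 0 < d) :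
    ∃ A : (n : ℕ) → ImpreciseSorting.RoundAlgorithm n d,
      ∀ (n : ℕ) (x : Fin n → ℝ) (C : ImpreciseSorting.AdaptiveComparator x),
        (((A n).comparisons C : ℕ) : ℝ) ≤ (n : ℝ) ^ (1 + 2 / Real.sqrt (d : ℝ)) * (d : ℝ) ∧
          ImpreciseSorting.IsApproxSorting x (2 * (d : ℝ)) ((A n).output C) := by
  have hex : ∀ n : ℕ, ∃ A : ImpreciseSorting.RoundAlgorithm n d,
      ∀ (x : Fin n → ℝ) (C : ImpreciseSorting.AdaptiveComparator x),
        ((A.comparisons C : ℕ) : ℝ) ≤ (n : ℝ) ^ (1 + 2 / Real.sqrt (d : ℝ)) * (d : ℝ) ∧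
          ImpreciseSorting.IsApproxSorting x (2 * (d : ℝ)) (A.output C) := by
    intro n
    rcases Nat.eq_zero_or_pos n with rfl | hn
    · obtain ⟨A, hA⟩ := (ImpreciseSorting.canSort_one 0 0).exists_algorithm (K := 2)
        (by simp) hd le_rfl
      refine ⟨A, fun x C => ⟨(hA x C).1.trans ?_, fun p => p.elim0⟩⟩
      simp only [Nat.cast_zero, mul_zero]
      positivity
    · obtain ⟨R, N, c, k, h, hN, hR, hk, hc⟩ := ImpreciseSorting.exists_canSort hd hn
      obtain ⟨A, hA⟩ := h.exists_algorithm hN hR hk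
      refine ⟨A, fun x C => ⟨(hA x C).1.trans ?_, (hA x C).2⟩⟩
      rw [Real.rpow_add (by exact_mod_cast hn), Real.rpow_one]
      calc c * n ≤ d * (n : ℝ) ^ (2 / √(d : ℝ)) * n := by gcongr
        _ = _ := by ring
  choose A hA using hex
  exact ⟨A, hA⟩
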